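/- Let $(M^n,g)$ be a closed (compact, without boundary) smooth Riemannian manifold of dimension $n$, with Riemannian volume measure $\mu_g$, and let $k\ge 0$ be an integer. Let $\mathcal H^k_g(M)$ be the space of harmonic $k$-forms, i.e. of smooth real $k$-forms $\alpha$ with $(dd^*+d^*d)\alpha=0$, where $d^*$ is the formal $L^2$-adjoint of $d$; write $|\cdot|$ for the pointwise norm of forms induced by $g$ and $\|\alpha\|_{L^2}^2=\int_M|\alpha|^2\,d\mu_g$. Let $K$ be the Schwartz kernel of the $L^2$-orthogonal projection onto $\mathcal H^k_g(M)$, i.e. the continuous section $K(x,y)\in\operatorname{Hom}(\Lambda^kT_y^*M,\Lambda^kT_x^*M)$ over $M\times M$ such that, for every smooth $k$-form $\omega$, the form $x\mapsto\int_M K(x,y)\,\omega(y)\,d\mu_g(y)$ is the $L^2$-orthogonal projection of $\omega$ onto $\mathcal H^k_g(M)$. Then for every $x\in M$ the supremum below is finite, and \[ 0\le \operatorname{Tr}K(x,x)\le\binom nk\ \sup_{\alpha\in\mathcal H^k_g(M),\ \|\alpha\|_{L^2}=1}|\alpha(x)|^2 , \] where the supremum is $0$ if $\mathcal H^k_g(M)=0$.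 -/

import Mathlib

open scoped Manifold ContDiff

namespace HarmonicKernel

noncomputable section

variable {n : ℕ} {M : Type*} [TopologicalSpace M] [ChartedSpace (EuclideanSpace ℝ (Fin n)) M]

/-- The fibre `Λᵏ T*ₓM`: alternating `k`-linear forms on the tangent space at `x`. -/
abbrev FormAt (n k : ℕ) {M : Type*} [TopologicalSpace M]
    [ChartedSpace (EuclideanSpace ℝ (Fin n)) M] (x : M) : Type :=
  TangentSpace (𝓡 n) x [⋀^Fin k]→L[ℝ] ℝ

/-- (Not necessarily smooth) differential `k`-forms on `M`. -/
abbrev Form (n k : ℕ) (M : Type*) [TopologicalSpace M]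
    [ChartedSpace (EuclideanSpace ℝ (Fin n)) M] : Type _ :=
  (x : M) → FormAt n k x

/-- Smooth Riemannian metrics on `M`. -/
abbrev Metric (n : ℕ) (M : Type*) [TopologicalSpace M]
    [ChartedSpace (EuclideanSpace ℝ (Fin n)) M] [IsManifold (𝓡 n) ∞ M] : Type _ :=
  Bundle.ContMDiffRiemannianMetric (𝓡 n) ∞ (EuclideanSpace ℝ (Fin n))
    (fun x : M => TangentSpace (𝓡 n) x)

/-- Derivative at `u` of the inverse of the preferred chart at `p`. -/
def chartInvDeriv (p : M) (u : EuclideanSpace ℝ (Fin n)) :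
    EuclideanSpace ℝ (Fin n) →L[ℝ] TangentSpace (𝓡 n) ((extChartAt (𝓡 n) p).symm u) :=
  mfderiv 𝓘(ℝ, EuclideanSpace ℝ (Fin n)) (𝓡 n) (extChartAt (𝓡 n) p).symm u

/-- Derivative at `p` of the preferred chart at `p`. -/
def chartDeriv (p : M) : TangentSpace (𝓡 n) p →L[ℝ] EuclideanSpace ℝ (Fin n) :=
  mfderiv (𝓡 n) 𝓘(ℝ, EuclideanSpace ℝ (Fin n)) (extChartAt (𝓡 n) p) p

/-- The form `α` read in the preferred chart at `p`, that is, its pullback by the inverse of the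
chart. It is meaningful on the (open) target of the chart. -/
def inChart {k : ℕ} (α : Form n k M) (p : M) (u : EuclideanSpace ℝ (Fin n)) :
    EuclideanSpace ℝ (Fin n) [⋀^Fin k]→L[ℝ] ℝ :=
  (α ((extChartAt (𝓡 n) p).symm u)).compContinuousLinearMap (chartInvDeriv p u)

/-- Smooth `k`-forms. -/
def IsSmooth {k : ℕ} (α : Form n k M) : Prop :=
  ∀ p : M, ContDiffOn ℝ ∞ (inChart α p) (extChartAt (𝓡 n) p).target

/-- The exterior derivative, computed at each point in the preferred chart there. -/
def extD {k : ℕ} (α : Form n k M) : Form n (k + 1) M := fun x =>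
  (extDeriv (inChart α x) (extChartAt (𝓡 n) x x)).compContinuousLinearMap (chartDeriv x)

/-- The standard basis of the model space, as a basis of the tangent space at `x` (which is the
model space as a vector space). -/
def stdVec (x : M) (i : Fin n) : TangentSpace (𝓡 n) x :=
  (EuclideanSpace.single i (1 : ℝ) : EuclideanSpace ℝ (Fin n))

variable [IsManifold (𝓡 n) ∞ M]

/-- Gram matrix `g_{ij}` of the metric at `x` in the basis `stdVec x`. -/
def gram (g : Metric n M) (x : M) : Matrix (Fin n) (Fin n) ℝ :=
  Matrix.of fun i j => g.inner x (stdVec x i) (stdVec x j)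

/-- The inner product on `Λᵏ T*ₓM` induced by the metric,
`⟨a, b⟩ = (1 / k!) ∑ g^{i₁j₁} ⋯ g^{iₖjₖ} a_{i₁…iₖ} b_{j₁…jₖ}`, where `(g^{ij})` is the inverse of
the Gram matrix. For an orthonormal coframe `(eⁱ)`, the forms `e^{i₁} ∧ ⋯ ∧ e^{iₖ}` with
`i₁ < ⋯ < iₖ` are orthonormal. -/
def formInner (g : Metric n M) {k : ℕ} (x : M) (a b : FormAt n k x) : ℝ :=
  ((k.factorial : ℝ))⁻¹ * ∑ I : Fin k → Fin n, ∑ J : Fin k → Fin n,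
    (∏ s : Fin k, (gram g x)⁻¹ (I s) (J s)) *
      a (fun s => stdVec x (I s)) * b (fun s => stdVec x (J s))

/-- The density `√det(g_{ij})` of the Riemannian volume in the preferred chart at `p`. -/
def volDensity (g : Metric n M) (p : M) (u : EuclideanSpace ℝ (Fin n)) : ℝ :=
  Real.sqrt (Matrix.det (Matrix.of fun i j : Fin n =>
    g.inner ((extChartAt (𝓡 n) p).symm u)
      (chartInvDeriv p u (EuclideanSpace.single i (1 : ℝ)))
      (chartInvDeriv p u (EuclideanSpace.single j (1 : ℝ)))))

/-- The Riemannian volume on the domain of the preferred chart at `p` (and zero outside it). -/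
def chartVolume [MeasurableSpace M] (g : Metric n M) (p : M) : MeasureTheory.Measure M :=
  ((MeasureTheory.volume.restrict (extChartAt (𝓡 n) p).target).withDensity
    (fun u => ENNReal.ofReal (volDensity g p u))).map (extChartAt (𝓡 n) p).symm

/-- A smooth partition of unity `(φ_p)` with the support of `φ_p` in the preferred chart at `p`. -/
def partition (n : ℕ) (M : Type*) [TopologicalSpace M]
    [ChartedSpace (EuclideanSpace ℝ (Fin n)) M] [IsManifold (𝓡 n) ∞ M]
    [CompactSpace M] [T2Space M] : SmoothPartitionOfUnity M (𝓡 n) M Set.univ :=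
  Classical.choose (SmoothPartitionOfUnity.exists_isSubordinate_chartAt_source (𝓡 n) M)

/-- The Riemannian volume measure `dμ_g = ∑_p φ_p √det(g_{ij}) du`, glued from the charts by a
partition of unity (the result does not depend on the partition). -/
def riemVolume [CompactSpace M] [T2Space M] [MeasurableSpace M] (g : Metric n M) :
    MeasureTheory.Measure M :=
  MeasureTheory.Measure.sum fun p : M =>
    (chartVolume g p).withDensity (fun x => ENNReal.ofReal (partition n M p x))

variable [CompactSpace M] [T2Space M] [MeasurableSpace M]

/-- The `L²` inner product of `k`-forms. -/
def l2Inner (g : Metric n M) {k : ℕ} (α β : Form n k M) : ℝ :=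
  ∫ x, formInner g x (α x) (β x) ∂(riemVolume g)

/-- `β = d* α`: the smooth form `β` is the value at `α` of the formal `L²` adjoint of `d`. -/
def IsCodifferential (g : Metric n M) {k : ℕ} (α : Form n (k + 1) M) (β : Form n k M) : Prop :=
  IsSmooth β ∧ ∀ γ : Form n k M, IsSmooth γ → l2Inner g β γ = l2Inner g α (extD γ)

/-- `η = Δ α` for the Hodge Laplacian `Δ = d d* + d* d` (which is `d* d` on functions). -/
def IsLaplacian (g : Metric n M) : {k : ℕ} → Form n k M → Form n k M → Prop
  | 0, α, η => IsCodifferential g (extD α) η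
  | _ + 1, α, η => ∃ β ζ, IsCodifferential g α β ∧ IsCodifferential g (extD α) ζ ∧
      η = extD β + ζ

/-- `α ∈ 𝓗ᵏ_g(M)`: the form `α` is smooth and `Δ α = 0`. -/
def IsHarmonic (g : Metric n M) {k : ℕ} (α : Form n k M) : Prop :=
  IsSmooth α ∧ IsLaplacian g α 0

/-- `η` is the `L²`-orthogonal projection of `θ` to the space of harmonic forms. -/
def IsHarmonicProjection (g : Metric n M) {k : ℕ} (θ η : Form n k M) : Prop :=
  IsHarmonic g η ∧ ∀ h : Form n k M, IsHarmonic g h → l2Inner g (θ - η) h = 0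

/-- `K` is the Schwartz kernel of the `L²`-orthogonal projection to the harmonic `k`-forms: a
continuous section `K(x, y) ∈ Hom(Λᵏ T*_yM, Λᵏ T*_xM)` over `M × M` (continuity is tested against
smooth forms) such that, for every smooth form `θ`, the form `x ↦ ∫ K(x, y) θ(y) dμ_g(y)` is the
projection of `θ`. The integral is the one of a function with values in the finite-dimensional
space `Λᵏ T*ₓM` and is evaluated on tangent vectors. -/
def IsHarmonicKernel (g : Metric n M) {k : ℕ}
    (K : (x y : M) → FormAt n k y →ₗ[ℝ] FormAt n k x) : Prop :=
  (∀ θ η : Form n k M, IsSmooth θ → IsSmooth η →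
    Continuous fun q : M × M => formInner g q.1 (K q.1 q.2 (θ q.2)) (η q.1)) ∧
  ∀ θ : Form n k M, IsSmooth θ → ∃ η : Form n k M, IsHarmonicProjection g θ η ∧
    ∀ (x : M) (v : Fin k → TangentSpace (𝓡 n) x),
      η x v = ∫ y, K x y (θ y) v ∂(riemVolume g)

/-- The values `|α(x)|²` for `α` harmonic with `‖α‖_{L²} = 1`. -/
def peakValues (g : Metric n M) (k : ℕ) (x : M) : Set ℝ :=
  {r | ∃ α : Form n k M, IsHarmonic g α ∧ l2Inner g α α = 1 ∧ r = formInner g x (α x) (α x)}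

end

end HarmonicKernel

open scoped Manifold ContDiff Topology MatrixOrder
open Filter MeasureTheory

/-! Test the kernel against smooth approximations of a point mass. Fix `x` and `b` in the fibre,
extend `b` to a smooth form `θ`, and let `f ≥ 0` be smooth of integral one, supported near `x`. Let
`η` be the harmonic projection of `f θ`. Orthogonality gives `‖η‖² = ⟨f θ, η⟩ = ∬ f(z) f(y) ⟨K(z,y)
θ(y), θ(z)⟩`, which tends to `κ = ⟨K(x,x) b, b⟩` as `f` concentrates at `x` (`tendsto_energy`).
Three consequences follow.

Positivity: `κ` is a limit of squared norms (`kernelPairing_diag_nonneg`).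

Finiteness: for harmonic `α`, `⟨f θ, α⟩ = ⟨η, α⟩`, so Cauchy–Schwarz in `L²` yields `⟨b, α(x)⟩² ≤ κ
‖α‖²` in the limit (`formInner_sq_le_kernelPairing`). Summed over an orthogonal basis of the fibre,
this bounds `|α(x)|²` by the trace when `‖α‖ = 1`.

Upper bound: with `S` the supremum, `⟨η(x), b⟩² ≤ |η(x)|² |b|² ≤ S ‖η‖² |b|²`. Both `⟨η(x), b⟩` and
`‖η‖²` tend to `κ`, so `κ² ≤ S |b|² κ`, that is `κ ≤ S |b|²` (`kernelPairing_diag_le`). Summing over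
the basis gives `dim Λᵏ ≤ C(n,k)` times `S`.

Neither an orthonormal basis of harmonic forms nor the finite dimension of their space is needed. -/

namespace HarmonicKernel

noncomputable section

/-! ### Linear algebra of the induced inner product on alternating forms. -/

section LinearAlgebra

variable {n k : ℕ} {F : Type*} [AddCommGroup F] [Module ℝ F] [TopologicalSpace F]

/-- The inner product of two alternating forms, computed from their components in a frame `v` with
Gram matrix `G`. -/
def frameInner (G : Matrix (Fin n) (Fin n) ℝ) (v : Fin n → F) (a b : F [⋀^Fin k]→L[ℝ] ℝ) : ℝ :=
  ((k.factorial : ℝ))⁻¹ * ∑ I : Fin k → Fin n, ∑ J : Fin k → Fin n,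
    (∏ s : Fin k, G⁻¹ (I s) (J s)) * a (fun s => v (I s)) * b (fun s => v (J s))

theorem alternating_apply_sum (A : Matrix (Fin n) (Fin n) ℝ) (v : Fin n → F)
    (a : F [⋀^Fin k]→L[ℝ] ℝ) (I : Fin k → Fin n) :
    a (fun s => ∑ j, A (I s) j • v j) =
      ∑ P : Fin k → Fin n, (∏ s, A (I s) (P s)) * a (fun s => v (P s)) := by
  have h := (a.toMultilinearMap).map_sum (fun s j => A (I s) j • v j)
  have h2 : ∀ P : Fin k → Fin n, a.toMultilinearMap (fun s => A (I s) (P s) • v (P s)) =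
      (∏ s, A (I s) (P s)) * a (fun s => v (P s)) := fun P =>
    (a.toMultilinearMap).map_smul_univ _ _
  exact h.trans (Finset.sum_congr rfl fun P _ => h2 P)

theorem prod_triple_product (A H : Matrix (Fin n) (Fin n) ℝ) (P Q : Fin k → Fin n) :
    ∏ s, (A.transpose * H * A) (P s) (Q s) =
      ∑ I : Fin k → Fin n, ∑ J : Fin k → Fin n,
        (∏ s, A (I s) (P s)) * (∏ s, H (I s) (J s)) * ∏ s, A (J s) (Q s) := by
  have h : ∀ s, (A.transpose * H * A) (P s) (Q s) =
      ∑ j, ∑ i, A i (P s) * H i j * A j (Q s) := by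
    intro s
    simp [Matrix.mul_apply, Finset.sum_mul]
  simp_rw [h, Finset.prod_univ_sum, Fintype.piFinset_univ]
  rw [Finset.sum_comm]
  simp_rw [Finset.prod_mul_distrib]

theorem sum_change_of_variables {ι : Type*} [Fintype ι] (A H : ι → ι → ℝ) (a b : ι → ℝ) :
    ∑ I, ∑ J, H I J * (∑ P, A I P * a P) * (∑ Q, A J Q * b Q) =
      ∑ P, ∑ Q, (∑ I, ∑ J, A I P * H I J * A J Q) * a P * b Q := by
  have h1 : ∀ I J, H I J * (∑ P, A I P * a P) * (∑ Q, A J Q * b Q) =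
      ∑ P, ∑ Q, A I P * H I J * A J Q * a P * b Q := by
    intro I J
    rw [mul_assoc, Finset.sum_mul_sum, Finset.mul_sum]
    simp_rw [Finset.mul_sum]
    exact Finset.sum_congr rfl fun P _ => Finset.sum_congr rfl fun Q _ => by ring
  simp_rw [h1, Finset.sum_mul]
  calc _ = ∑ I, ∑ P, ∑ J, ∑ Q, A I P * H I J * A J Q * a P * b Q :=
        Finset.sum_congr rfl fun I _ => Finset.sum_comm
    _ = ∑ P, ∑ I, ∑ Q, ∑ J, A I P * H I J * A J Q * a P * b Q := by
        rw [Finset.sum_comm]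
        exact Finset.sum_congr rfl fun P _ => Finset.sum_congr rfl fun I _ => Finset.sum_comm
    _ = _ := Finset.sum_congr rfl fun P _ => Finset.sum_comm

/-- The inner product of forms does not depend on the frame. -/
theorem frameInner_change (A G : Matrix (Fin n) (Fin n) ℝ) (hA : IsUnit A.det)
    (v : Fin n → F) (a b : F [⋀^Fin k]→L[ℝ] ℝ) :
    frameInner (A * G * A.transpose) (fun i => ∑ j, A i j • v j) a b = frameInner G v a b := by
  -- The inverse Gram matrix transforms contragrediently, so it absorbs the factors `A` produced by
  -- expanding the new frame in the old one.
  have hG : A.transpose * (A * G * A.transpose)⁻¹ * A = G⁻¹ := by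
    have hA' : IsUnit A.transpose.det := by rwa [Matrix.det_transpose]
    rw [Matrix.mul_inv_rev, Matrix.mul_inv_rev, Matrix.mul_nonsing_inv_cancel_left _ _ hA',
      Matrix.mul_assoc, Matrix.nonsing_inv_mul _ hA, Matrix.mul_one]
  unfold frameInner
  congr 1
  rw [← hG]
  simp_rw [prod_triple_product, alternating_apply_sum]
  exact sum_change_of_variables (fun I P : Fin k → Fin n => ∏ s, A (I s) (P s)) _ _ _

/-- A positive definite Gram matrix is turned into the identity by a change of frame. -/
theorem exists_orthonormalizing (G : Matrix (Fin n) (Fin n) ℝ) (hG : G.PosDef) :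
    ∃ A : Matrix (Fin n) (Fin n) ℝ, IsUnit A.det ∧ A * G * A.transpose = 1 := by
  -- Factor `G = yᵀ y` with `y` invertible; then `A = (yᵀ)⁻¹` works.
  obtain ⟨y, hy, rfl⟩ := CStarAlgebra.isStrictlyPositive_iff_eq_star_mul_self.mp
    hG.isStrictlyPositive
  have hy' : IsUnit y.det := (Matrix.isUnit_iff_isUnit_det y).1 hy
  have hyt : IsUnit y.transpose.det := by rwa [Matrix.det_transpose]
  have hs : star y = y.transpose := by
    rw [Matrix.star_eq_conjTranspose, Matrix.conjTranspose_eq_transpose_of_trivial]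
  refine ⟨y.transpose⁻¹, (Matrix.isUnit_nonsing_inv_det_iff).2 hyt, ?_⟩
  rw [hs, Matrix.transpose_nonsing_inv, Matrix.transpose_transpose,
    Matrix.nonsing_inv_mul_cancel_left _ _ hyt, Matrix.mul_nonsing_inv _ hy']

/-- Once the Gram matrix is the identity, only the terms `I = J` survive. Symmetry and positivity
can be read off from the resulting sum. -/
theorem exists_orthonormal_frame (G : Matrix (Fin n) (Fin n) ℝ) (hG : G.PosDef)
    (v : Fin n → F) :
    ∃ A : Matrix (Fin n) (Fin n) ℝ, IsUnit A.det ∧ ∀ a b : F [⋀^Fin k]→L[ℝ] ℝ,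
      frameInner G v a b = ((k.factorial : ℝ))⁻¹ * ∑ I : Fin k → Fin n,
        a (fun s => ∑ j, A (I s) j • v j) * b (fun s => ∑ j, A (I s) j • v j) := by
  obtain ⟨A, hA, h1⟩ := exists_orthonormalizing G hG
  refine ⟨A, hA, fun a b => ?_⟩
  rw [← frameInner_change A G hA, h1]
  unfold frameInner
  congr 1
  refine Finset.sum_congr rfl fun I _ => ?_
  rw [Finset.sum_eq_single I]
  · simp
  · intro J _ hJ
    obtain ⟨s, hs⟩ := Function.ne_iff.1 hJ
    rw [Finset.prod_eq_zero (Finset.mem_univ s)]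
    · simp
    · simp [hs.symm]
  · simp

/-- The inner product of forms in a frame, as a bilinear form. -/
def frameBilin (G : Matrix (Fin n) (Fin n) ℝ) (v : Fin n → F) :
    LinearMap.BilinForm ℝ (F [⋀^Fin k]→L[ℝ] ℝ) :=
  LinearMap.mk₂ ℝ (frameInner G v)
    (by intro a a' b; simp [frameInner, mul_add, add_mul, Finset.sum_add_distrib])
    (by
      intro c a b
      simp only [frameInner, ContinuousAlternatingMap.smul_apply, smul_eq_mul, Finset.mul_sum]
      refine Finset.sum_congr rfl fun I _ => Finset.sum_congr rfl fun J _ => by ring)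
    (by intro a b b'; simp [frameInner, mul_add, Finset.sum_add_distrib])
    (by
      intro c a b
      simp only [frameInner, ContinuousAlternatingMap.smul_apply, smul_eq_mul, Finset.mul_sum]
      refine Finset.sum_congr rfl fun I _ => Finset.sum_congr rfl fun J _ => by ring)

@[simp] theorem frameBilin_apply (G : Matrix (Fin n) (Fin n) ℝ) (v : Fin n → F)
    (a b : F [⋀^Fin k]→L[ℝ] ℝ) : frameBilin G v a b = frameInner G v a b := rfl

theorem frameBilin_isSymm (G : Matrix (Fin n) (Fin n) ℝ) (hG : G.PosDef) (v : Fin n → F) :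
    LinearMap.IsSymm (frameBilin (k := k) G v) := by
  obtain ⟨A, -, h⟩ := exists_orthonormal_frame (k := k) G hG v
  refine ⟨fun a b => ?_⟩
  simp only [frameBilin_apply, h, RingHom.id_apply]
  simp_rw [mul_comm]

theorem frameInner_self_nonneg (G : Matrix (Fin n) (Fin n) ℝ) (hG : G.PosDef) (v : Fin n → F)
    (a : F [⋀^Fin k]→L[ℝ] ℝ) : 0 ≤ frameInner G v a a := by
  obtain ⟨A, -, h⟩ := exists_orthonormal_frame (k := k) G hG v
  rw [h]
  exact mul_nonneg (by positivity) (Finset.sum_nonneg fun I _ => mul_self_nonneg _)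

theorem frame_apply_eq_zero (G : Matrix (Fin n) (Fin n) ℝ) (hG : G.PosDef) (v : Fin n → F)
    (a : F [⋀^Fin k]→L[ℝ] ℝ) (ha : frameInner G v a a = 0) (I : Fin k → Fin n) :
    a (fun s => v (I s)) = 0 := by
  obtain ⟨A, hA, h⟩ := exists_orthonormal_frame (k := k) G hG v
  rw [h, mul_eq_zero, Finset.sum_eq_zero_iff_of_nonneg fun I _ => mul_self_nonneg _] at ha
  have h0 : ∀ I : Fin k → Fin n, a (fun s => ∑ j, A (I s) j • v j) = 0 := fun I =>
    mul_self_eq_zero.1 ((ha.resolve_left (by positivity)) I (Finset.mem_univ _))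
  -- The sum of squares kills the components in the new frame; `A⁻¹` carries this back to `v`.
  have h2 : ∀ i, v i = ∑ j, A⁻¹ i j • ∑ l, A j l • v l := by
    intro i
    simp_rw [Finset.smul_sum, smul_smul]
    rw [Finset.sum_comm]
    simp_rw [← Finset.sum_smul, ← Matrix.mul_apply, Matrix.nonsing_inv_mul _ hA]
    simp [Matrix.one_apply]
  simp_rw [h2 (I _)]
  rw [alternating_apply_sum A⁻¹ (fun j => ∑ l, A j l • v l)]
  simp [h0]

/-- A continuous alternating form, as a linear form on the exterior power. -/
def toExteriorDual :
    (F [⋀^Fin k]→L[ℝ] ℝ) →ₗ[ℝ] Module.Dual ℝ (⋀[ℝ]^k F) :=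
  (exteriorPower.alternatingMapLinearEquiv (R := ℝ) (N := ℝ)).toLinearMap ∘ₗ
    ContinuousAlternatingMap.toAlternatingMapLinear

theorem toExteriorDual_injective :
    Function.Injective (toExteriorDual (k := k) (F := F)) :=
  (exteriorPower.alternatingMapLinearEquiv (R := ℝ) (N := ℝ)).injective.comp
    ContinuousAlternatingMap.toAlternatingMap_injective

theorem finiteDimensional_alternating [FiniteDimensional ℝ F] :
    FiniteDimensional ℝ (F [⋀^Fin k]→L[ℝ] ℝ) :=
  FiniteDimensional.of_injective _ toExteriorDual_injective

/-- Alternating forms embed in the dual of the exterior power, whose dimension is the binomial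
coefficient; the theorem needs only this inequality. -/
theorem finrank_alternating_le [FiniteDimensional ℝ F] :
    Module.finrank ℝ (F [⋀^Fin k]→L[ℝ] ℝ) ≤ (Module.finrank ℝ F).choose k := by
  rw [← exteriorPower.finrank_eq (R := ℝ), ← Subspace.dual_finrank_eq (V := ⋀[ℝ]^k F)]
  exact LinearMap.finrank_le_finrank_of_injective (f := toExteriorDual)
    toExteriorDual_injective

end LinearAlgebra

/-! ### Coordinates, trace and Parseval identity in an orthogonal, not normalized, basis. -/

section OrthogonalBasis

variable {V : Type*} [AddCommGroup V] [Module ℝ V] {ι : Type*} [Fintype ι]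

theorem orthogonal_repr (B : LinearMap.BilinForm ℝ V) (hpos : ∀ a, a ≠ 0 → 0 < B a a)
    (b : Module.Basis ι ℝ V) (hb : LinearMap.IsOrthoᵢ B b) (a : V) (i : ι) :
    b.repr a i = B a (b i) / B (b i) (b i) := by
  classical
  rw [eq_div_iff (hpos _ (b.ne_zero i)).ne']
  conv_rhs => rw [← b.sum_repr a]
  simp only [map_sum, map_smul, LinearMap.sum_apply, LinearMap.smul_apply, smul_eq_mul]
  rw [Finset.sum_eq_single i]
  · intro j _ hj
    rw [LinearMap.isOrthoᵢ_def.1 hb j i hj, mul_zero]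
  · simp

theorem orthogonal_trace (B : LinearMap.BilinForm ℝ V) (hpos : ∀ a, a ≠ 0 → 0 < B a a)
    (b : Module.Basis ι ℝ V) (hb : LinearMap.IsOrthoᵢ B b) (T : V →ₗ[ℝ] V) :
    LinearMap.trace ℝ V T = ∑ i, B (T (b i)) (b i) / B (b i) (b i) := by
  classical
  rw [LinearMap.trace_eq_matrix_trace ℝ b, Matrix.trace]
  refine Finset.sum_congr rfl fun i _ => ?_
  rw [Matrix.diag_apply, LinearMap.toMatrix_apply, orthogonal_repr B hpos b hb]

theorem orthogonal_self (B : LinearMap.BilinForm ℝ V) (hpos : ∀ a, a ≠ 0 → 0 < B a a)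
    (b : Module.Basis ι ℝ V) (hb : LinearMap.IsOrthoᵢ B b) (a : V) :
    B a a = ∑ i, B a (b i) ^ 2 / B (b i) (b i) := by
  have h : B a a = B a (∑ i, b.repr a i • b i) := by rw [b.sum_repr]
  rw [h, map_sum]
  refine Finset.sum_congr rfl fun i _ => ?_
  rw [map_smul, smul_eq_mul, orthogonal_repr B hpos b hb]
  ring

end OrthogonalBasis

/-! ### Forms and metric in charts: continuity of inner products, existence of smooth forms. -/

section Chart

variable {n k : ℕ} {M : Type*} [TopologicalSpace M] [ChartedSpace (EuclideanSpace ℝ (Fin n)) M]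

theorem range_model : Set.range (𝓡 n) = Set.univ := by simp

theorem isOpen_chartTarget (p : M) : IsOpen (extChartAt (𝓡 n) p).target :=
  isOpen_extChartAt_target p

theorem continuousOn_frameInner {X : Type*} [TopologicalSpace X] {s : Set X}
    {G : X → Matrix (Fin n) (Fin n) ℝ} {v : Fin n → EuclideanSpace ℝ (Fin n)}
    {a b : X → EuclideanSpace ℝ (Fin n) [⋀^Fin k]→L[ℝ] ℝ} (hG : ContinuousOn G s)
    (hdet : ∀ u ∈ s, (G u).det ≠ 0) (ha : ContinuousOn a s) (hb : ContinuousOn b s) :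
    ContinuousOn (fun u => frameInner (G u) v (a u) (b u)) s := by
  have hinv : ∀ i j, ContinuousOn (fun u => (G u)⁻¹ i j) s := by
    intro i j
    simp_rw [Matrix.inv_def, Matrix.smul_apply, Ring.inverse_eq_inv', smul_eq_mul]
    have hd : ContinuousOn (fun u => (G u).det) s :=
      (continuous_id.matrix_det).comp_continuousOn hG
    refine (hd.inv₀ hdet).mul ?_
    exact ((continuous_id.matrix_adjugate).matrix_elem i j).comp_continuousOn hG
  have hev : ∀ (c : X → EuclideanSpace ℝ (Fin n) [⋀^Fin k]→L[ℝ] ℝ), ContinuousOn c s →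
      ∀ m, ContinuousOn (fun u => c u m) s := fun c hc m =>
    (ContinuousAlternatingMap.apply ℝ (EuclideanSpace ℝ (Fin n)) ℝ m).continuous.comp_continuousOn hc
  unfold frameInner
  refine continuousOn_const.mul (continuousOn_finsetSum _ fun I _ =>
    continuousOn_finsetSum _ fun J _ => ?_)
  exact ((continuousOn_finsetProd _ fun s _ => hinv _ _).mul (hev a ha _)).mul (hev b hb _)

theorem inChart_smul (f : M → ℝ) (α : Form n k M) (p : M) (u : EuclideanSpace ℝ (Fin n)) :
    inChart (fun x => f x • α x) p u = f ((extChartAt (𝓡 n) p).symm u) • inChart α p u := by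
  ext; rfl

theorem IsSmooth.sub {α β : Form n k M} (hα : IsSmooth α) (hβ : IsSmooth β) :
    IsSmooth (α - β) := fun p => (hα p).sub (hβ p)

theorem IsSmooth.const_smul {α : Form n k M} (hα : IsSmooth α) (c : ℝ) :
    IsSmooth (c • α) := fun p => (hα p).const_smul c

theorem sum_stdVec (x : M) (w : TangentSpace (𝓡 n) x) :
    ∑ j, (show EuclideanSpace ℝ (Fin n) from w) j • stdVec x j = w := by
  have h := (EuclideanSpace.basisFun (Fin n) ℝ).sum_repr (show EuclideanSpace ℝ (Fin n) from w)
  simp only [EuclideanSpace.basisFun_apply] at h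
  exact h

theorem single_linearIndependent :
    LinearIndependent ℝ (fun i : Fin n => EuclideanSpace.single i (1 : ℝ)) := by
  have h := (EuclideanSpace.basisFun (Fin n) ℝ).orthonormal.linearIndependent
  rwa [funext (EuclideanSpace.basisFun_apply (Fin n) ℝ)] at h

theorem stdVec_linearIndependent (x : M) : LinearIndependent ℝ (stdVec (n := n) x) :=
  single_linearIndependent

variable [IsManifold (𝓡 n) ∞ M]

instance instIsManifoldOne : IsManifold (𝓡 n) 1 M := IsManifold.of_le (n := ∞) (by simp)

theorem chartInvDeriv_isInvertible (p : M) {u : EuclideanSpace ℝ (Fin n)}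
    (hu : u ∈ (extChartAt (𝓡 n) p).target) : (chartInvDeriv p u).IsInvertible := by
  have h := isInvertible_mfderivWithin_extChartAt_symm hu
  rw [range_model, mfderivWithin_univ] at h
  exact h

/-- This is the tangent map of the inverse chart applied to a constant vector field. Since the fibre
moves with `u`, continuity is stated in the total space. -/
theorem continuousOn_chartInvDeriv (p : M) (e : EuclideanSpace ℝ (Fin n)) :
    ContinuousOn (fun u => (⟨(extChartAt (𝓡 n) p).symm u, chartInvDeriv p u e⟩ :
      TangentBundle (𝓡 n) M)) (extChartAt (𝓡 n) p).target := by
  have h := (contMDiffOn_extChartAt_symm (I := 𝓡 n) (n := 1) p).continuousOn_tangentMapWithin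
    le_rfl (isOpen_chartTarget p).uniqueMDiffOn
  have h2 : Continuous (fun u : EuclideanSpace ℝ (Fin n) =>
      (⟨u, e⟩ : TangentBundle 𝓘(ℝ, EuclideanSpace ℝ (Fin n)) (EuclideanSpace ℝ (Fin n)))) := by
    exact ((tangentBundleModelSpaceHomeomorph 𝓘(ℝ, EuclideanSpace ℝ (Fin n))).symm.continuous.comp
      (continuous_id.prodMk continuous_const))
  refine (h.comp h2.continuousOn (fun u hu => hu)).congr fun u hu => ?_
  simp only [tangentMapWithin, Function.comp, chartInvDeriv]
  rw [mfderivWithin_of_isOpen (isOpen_chartTarget p) hu]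
  rfl

/-- Gram matrix of the metric in the coordinate frame of the preferred chart at `p`. -/
def chartGram (g : Metric n M) (p : M) (u : EuclideanSpace ℝ (Fin n)) :
    Matrix (Fin n) (Fin n) ℝ :=
  Matrix.of fun i j : Fin n => g.inner ((extChartAt (𝓡 n) p).symm u)
      (chartInvDeriv p u (EuclideanSpace.single i (1 : ℝ)))
      (chartInvDeriv p u (EuclideanSpace.single j (1 : ℝ)))

theorem continuousOn_chartGram (g : Metric n M) (p : M) :
    ContinuousOn (chartGram g p) (extChartAt (𝓡 n) p).target := by
  refine continuousOn_pi.2 fun i => continuousOn_pi.2 fun j => ?_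
  intro u hu
  have h1 := continuousOn_chartInvDeriv (M := M) p (EuclideanSpace.single i (1 : ℝ)) u hu
  have h2 := continuousOn_chartInvDeriv (M := M) p (EuclideanSpace.single j (1 : ℝ)) u hu
  have hg : ContinuousWithinAt (fun u => (⟨(extChartAt (𝓡 n) p).symm u,
      g.inner ((extChartAt (𝓡 n) p).symm u)⟩ : Bundle.TotalSpace
        (EuclideanSpace ℝ (Fin n) →L[ℝ] EuclideanSpace ℝ (Fin n) →L[ℝ] ℝ)
        (fun x : M => TangentSpace (𝓡 n) x →L[ℝ] TangentSpace (𝓡 n) x →L[ℝ] ℝ)))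
      (extChartAt (𝓡 n) p).target u :=
    g.contMDiff.continuous.continuousAt.comp_continuousWithinAt
      (f := (extChartAt (𝓡 n) p).symm) (continuousOn_extChartAt_symm p u hu)
  have h3 := hg.clm_bundle_apply₂ (F₁ := EuclideanSpace ℝ (Fin n))
    (F₂ := EuclideanSpace ℝ (Fin n)) (F₃ := ℝ) (E₃ := Bundle.Trivial M ℝ) h1 h2
  rw [FiberBundle.continuousWithinAt_totalSpace] at h3
  exact h3.2

theorem inner_sum_sum (g : Metric n M) (x : M) {ι : Type*} [Fintype ι] (c d : ι → ℝ)
    (v w : ι → TangentSpace (𝓡 n) x) :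
    g.inner x (∑ i, c i • v i) (∑ j, d j • w j) = ∑ i, ∑ j, c i * g.inner x (v i) (w j) * d j := by
  simp only [map_sum, map_smul, _root_.sum_apply, _root_.smul_apply,
    smul_eq_mul, Finset.mul_sum]
  rw [Finset.sum_comm]
  exact Finset.sum_congr rfl fun i _ => Finset.sum_congr rfl fun j _ => by ring

theorem gramMatrix_posDef (g : Metric n M) (x : M) (w : Fin n → TangentSpace (𝓡 n) x)
    (hw : LinearIndependent ℝ w) :
    (Matrix.of fun i j => g.inner x (w i) (w j) : Matrix (Fin n) (Fin n) ℝ).PosDef := by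
  rw [Matrix.posDef_iff_dotProduct_mulVec]
  refine ⟨Matrix.IsHermitian.ext fun i j => ?_, fun c hc => ?_⟩
  · simpa using g.symm x (w j) (w i)
  · have h : star c ⬝ᵥ (Matrix.of fun i j => g.inner x (w i) (w j) : Matrix _ _ ℝ).mulVec c =
        g.inner x (∑ i, c i • w i) (∑ i, c i • w i) := by
      rw [inner_sum_sum]
      simp [dotProduct, Matrix.mulVec, Finset.mul_sum, mul_assoc]
    rw [h]
    apply g.pos
    intro h0
    exact hc (funext fun i => Fintype.linearIndependent_iff.1 hw c h0 i)

theorem chartGram_posDef (g : Metric n M) (p : M) {u : EuclideanSpace ℝ (Fin n)}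
    (hu : u ∈ (extChartAt (𝓡 n) p).target) : (chartGram g p u).PosDef := by
  apply gramMatrix_posDef g _ (fun i => chartInvDeriv p u (EuclideanSpace.single i (1 : ℝ)))
  refine single_linearIndependent.map' (chartInvDeriv p u).toLinearMap ?_
  rw [LinearMap.ker_eq_bot]
  exact (chartInvDeriv_isInvertible p hu).injective

theorem gram_posDef (g : Metric n M) (x : M) : (gram g x).PosDef :=
  gramMatrix_posDef g x (stdVec x) (stdVec_linearIndependent x)

theorem formInner_eq_frameInner (g : Metric n M) (x : M) (a b : FormAt n k x) :
    formInner g x a b = frameInner (gram g x) (stdVec x) a b := rfl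

/-- The frame `stdVec` comes from the preferred chart at each point and may jump from point to
point. Passing to the coordinate frame of one fixed chart makes continuity visible. -/
theorem formInner_eq_chart (g : Metric n M) (p : M) {u : EuclideanSpace ℝ (Fin n)}
    (hu : u ∈ (extChartAt (𝓡 n) p).target) (α β : Form n k M) :
    formInner g ((extChartAt (𝓡 n) p).symm u) (α _) (β _) =
      frameInner (chartGram g p u) (fun i => EuclideanSpace.single i (1 : ℝ))
        (inChart α p u) (inChart β p u) := by
  set y := (extChartAt (𝓡 n) p).symm u with hy
  let w : Fin n → TangentSpace (𝓡 n) y :=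
    fun i => chartInvDeriv p u (EuclideanSpace.single i (1 : ℝ))
  let A : Matrix (Fin n) (Fin n) ℝ :=
    Matrix.of fun i j => (show EuclideanSpace ℝ (Fin n) from w i) j
  have hw : ∀ i, ∑ j, A i j • stdVec y j = w i := fun i => sum_stdVec y (w i)
  have hG : A * gram g y * A.transpose = chartGram g p u := by
    ext i j
    have h1 : chartGram g p u i j = g.inner y (w i) (w j) := rfl
    rw [h1, ← hw i, ← hw j, inner_sum_sum, Matrix.mul_apply]
    simp_rw [Matrix.mul_apply, Finset.sum_mul]
    rw [Finset.sum_comm]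
    rfl
  -- `det A` divides the determinant of `chartGram`, which is positive.
  have hA : IsUnit A.det := by
    have h := (chartGram_posDef g p hu).det_pos.ne'
    rw [← hG, Matrix.det_mul, Matrix.det_mul] at h
    exact isUnit_iff_ne_zero.2 fun h0 => h (by simp [h0])
  have h := frameInner_change A (gram g y) hA (stdVec y) (α y) (β y)
  rw [hG] at h
  rw [formInner_eq_frameInner, ← h]
  simp_rw [hw]
  rfl

/-- The pointwise inner product of two smooth forms is continuous. -/
theorem continuous_formInner (g : Metric n M) {α β : Form n k M} (hα : IsSmooth α)
    (hβ : IsSmooth β) : Continuous fun x => formInner g x (α x) (β x) := by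
  refine continuous_iff_continuousAt.2 fun p => ?_
  have h : ContinuousOn (fun u => formInner g ((extChartAt (𝓡 n) p).symm u) (α _) (β _))
      (extChartAt (𝓡 n) p).target :=
    (continuousOn_frameInner (continuousOn_chartGram g p)
      (fun u hu => (chartGram_posDef g p hu).det_pos.ne') (hα p).continuousOn
      (hβ p).continuousOn).congr fun u hu => formInner_eq_chart g p hu α β
  have h2 := ContinuousAt.comp (f := extChartAt (𝓡 n) p) (x := p)
    (h.continuousAt ((isOpen_chartTarget p).mem_nhds (mem_extChartAt_target p)))
    (continuousAt_extChartAt p)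
  refine h2.congr ?_
  filter_upwards [extChartAt_source_mem_nhds (I := 𝓡 n) p] with y hy
  simp only [Function.comp]
  rw [(extChartAt (𝓡 n) p).left_inv hy]

theorem IsSmooth.fun_smul {α : Form n k M} (hα : IsSmooth α) {f : M → ℝ}
    (hf : ContMDiff (𝓡 n) 𝓘(ℝ) ∞ f) : IsSmooth fun x => f x • α x := by
  intro p
  have h1 : ContDiffOn ℝ ∞ (fun u => f ((extChartAt (𝓡 n) p).symm u))
      (extChartAt (𝓡 n) p).target :=
    (hf.comp_contMDiffOn (contMDiffOn_extChartAt_symm (I := 𝓡 n) p)).contDiffOn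
  exact (h1.smul (hα p)).congr fun u _ => inChart_smul f α p u

/-- The components on the standard basis embed the finite-dimensional space of forms in a coordinate
space, and a linear left inverse is automatically smooth. -/
theorem contDiffAt_alternating_of_apply {X : Type*} [NormedAddCommGroup X] [NormedSpace ℝ X]
    {c : X → EuclideanSpace ℝ (Fin n) [⋀^Fin k]→L[ℝ] ℝ} {u : X}
    (h : ∀ m, ContDiffAt ℝ ∞ (fun t => c t m) u) : ContDiffAt ℝ ∞ c u := by
  have : FiniteDimensional ℝ (EuclideanSpace ℝ (Fin n) [⋀^Fin k]→L[ℝ] ℝ) :=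
    finiteDimensional_alternating
  let ψ : (EuclideanSpace ℝ (Fin n) [⋀^Fin k]→L[ℝ] ℝ) →ₗ[ℝ] ((Fin k → Fin n) → ℝ) :=
    { toFun := fun a I => a fun s => EuclideanSpace.single (I s) (1 : ℝ)
      map_add' := fun a b => by ext; simp
      map_smul' := fun r a => by ext; simp }
  have hψ : LinearMap.ker ψ = ⊥ := by
    rw [LinearMap.ker_eq_bot, injective_iff_map_eq_zero]
    intro a ha
    apply ContinuousAlternatingMap.toAlternatingMap_injective
    refine Module.Basis.ext_alternating (EuclideanSpace.basisFun (Fin n) ℝ).toBasis fun I _ => ?_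
    have h0 : a (fun s => EuclideanSpace.single (I s) (1 : ℝ)) = 0 := congrFun ha I
    simpa using h0
  obtain ⟨r, hr⟩ := ψ.exists_leftInverse_of_injective hψ
  have h1 : c = fun t => r.toContinuousLinearMap (ψ (c t)) := by
    ext1 t
    exact (LinearMap.congr_fun hr (c t)).symm
  rw [h1]
  exact r.toContinuousLinearMap.contDiff.contDiffAt.comp u (contDiffAt_pi.2 fun I => h _)

theorem ContDiffAt.alternating_pullback {u : EuclideanSpace ℝ (Fin n)}
    (a : EuclideanSpace ℝ (Fin n) [⋀^Fin k]→L[ℝ] ℝ)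
    {L : EuclideanSpace ℝ (Fin n) → EuclideanSpace ℝ (Fin n) →L[ℝ] EuclideanSpace ℝ (Fin n)}
    (hL : ContDiffAt ℝ ∞ L u) : ContDiffAt ℝ ∞ (fun t => a.compContinuousLinearMap (L t)) u := by
  refine contDiffAt_alternating_of_apply fun m => ?_
  have h1 : ContDiffAt ℝ ∞ (fun t => fun s => L t (m s)) u :=
    contDiffAt_pi.2 fun s => hL.clm_apply contDiffAt_const
  exact (a.toContinuousMultilinearMap.contDiff (n := ∞)).contDiffAt.comp u h1

/-- Every value at a point is taken by a smooth form. -/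
theorem exists_smooth_form [T2Space M] (x : M) (a : FormAt n k x) :
    ∃ θ : Form n k M, IsSmooth θ ∧ θ x = a := by
  -- The form is the pullback by the chart at `x` of a constant form `a'`, chosen to give `a` at
  -- `x`, cut off by a bump function supported in the chart domain.
  let D : (y : M) → TangentSpace (𝓡 n) y →L[ℝ] EuclideanSpace ℝ (Fin n) :=
    fun y => mfderiv (𝓡 n) 𝓘(ℝ, EuclideanSpace ℝ (Fin n)) (extChartAt (𝓡 n) x) y
  obtain ⟨e, he⟩ : ∃ e : TangentSpace (𝓡 n) x ≃L[ℝ] EuclideanSpace ℝ (Fin n), e = D x :=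
    isInvertible_mfderiv_extChartAt (I := 𝓡 n) (x := x) (y := x) (mem_extChartAt_source x)
  let a' : EuclideanSpace ℝ (Fin n) [⋀^Fin k]→L[ℝ] ℝ :=
    a.compContinuousLinearMap (e.symm : EuclideanSpace ℝ (Fin n) →L[ℝ] TangentSpace (𝓡 n) x)
  obtain ⟨ρ⟩ : Nonempty (SmoothBumpFunction (𝓡 n) x) := inferInstance
  refine ⟨fun y => ρ y • a'.compContinuousLinearMap (D y), fun p => ?_, ?_⟩
  · refine fun u hu => ContDiffAt.contDiffWithinAt ?_
    have hcont : ContinuousAt (extChartAt (𝓡 n) p).symm u := continuousAt_extChartAt_symm'' hu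
    by_cases hs : (extChartAt (𝓡 n) p).symm u ∈ tsupport ρ
    · have hW : IsOpen ((extChartAt (𝓡 n) p).target ∩
          (extChartAt (𝓡 n) p).symm ⁻¹' (extChartAt (𝓡 n) x).source) :=
        (continuousOn_extChartAt_symm p).isOpen_inter_preimage (isOpen_chartTarget p)
          (isOpen_extChartAt_source x)
      set W := (extChartAt (𝓡 n) p).target ∩
          (extChartAt (𝓡 n) p).symm ⁻¹' (extChartAt (𝓡 n) x).source with hWdef
      have huW : u ∈ W := ⟨hu, by
        simpa using ρ.tsupport_subset_chartAt_source hs⟩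
      let τ : EuclideanSpace ℝ (Fin n) → EuclideanSpace ℝ (Fin n) :=
        extChartAt (𝓡 n) x ∘ (extChartAt (𝓡 n) p).symm
      have hτ : ContDiffOn ℝ ∞ τ W :=
        ((contMDiffOn_extChartAt (I := 𝓡 n) (n := ∞) (x := x)).comp
          ((contMDiffOn_extChartAt_symm (I := 𝓡 n) p).mono Set.inter_subset_left)
            (fun t ht => by simpa using ht.2)).contDiffOn
      have hdτ : ContDiffAt ℝ ∞ (fderiv ℝ τ) u :=
        (hτ.fderiv_of_isOpen hW (by simp)).contDiffAt (hW.mem_nhds huW)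
      have hρ : ContDiffAt ℝ ∞ (fun t => ρ ((extChartAt (𝓡 n) p).symm t)) u :=
        ((ρ.contMDiff.comp_contMDiffOn
          (contMDiffOn_extChartAt_symm (I := 𝓡 n) p)).contDiffOn).contDiffAt
            ((isOpen_chartTarget p).mem_nhds hu)
      refine (hρ.smul (ContDiffAt.alternating_pullback a' hdτ)).congr_of_eventuallyEq ?_
      filter_upwards [hW.mem_nhds huW] with t ht
      -- By the chain rule, in the chart at `p` the form is the pullback of `a'` by the transition
      -- map `τ`.
      have hc : fderiv ℝ τ t = (D ((extChartAt (𝓡 n) p).symm t)).comp (chartInvDeriv p t) := by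
        rw [← mfderiv_eq_fderiv]
        exact mfderiv_comp t (mdifferentiableAt_extChartAt (by simpa using ht.2))
          (((contMDiffOn_extChartAt_symm (I := 𝓡 n) (n := 1) p).contMDiffAt
            ((isOpen_chartTarget p).mem_nhds ht.1)).mdifferentiableAt (by simp))
      simp only [Pi.smul_apply', hc]
      rfl
    · have h0 : ∀ᶠ t in 𝓝 u, (extChartAt (𝓡 n) p).symm t ∈ (tsupport ρ)ᶜ :=
        hcont.eventually_mem ((isClosed_tsupport ρ).isOpen_compl.mem_nhds hs)
      refine (contDiffAt_const (c := 0)).congr_of_eventuallyEq ?_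
      filter_upwards [h0] with t ht
      rw [inChart_smul ρ, image_eq_zero_of_notMem_tsupport ht, zero_smul]
  · have h1 : ρ x = 1 := ρ.eventuallyEq_one.eq_of_nhds
    simp only [h1, one_smul, ← he]
    ext m
    simp [a', Function.comp_def]

end Chart

/-! ### The Riemannian volume is finite, and positive on nonempty open sets. -/

section Volume

variable {n : ℕ} {M : Type*} [TopologicalSpace M] [ChartedSpace (EuclideanSpace ℝ (Fin n)) M]
  [IsManifold (𝓡 n) ∞ M]

theorem continuousOn_volDensity (g : Metric n M) (p : M) :
    ContinuousOn (volDensity g p) (extChartAt (𝓡 n) p).target :=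
  Real.continuous_sqrt.comp_continuousOn
    ((continuous_id.matrix_det).comp_continuousOn (continuousOn_chartGram g p))

theorem volDensity_pos (g : Metric n M) (p : M) {u : EuclideanSpace ℝ (Fin n)}
    (hu : u ∈ (extChartAt (𝓡 n) p).target) : 0 < volDensity g p u :=
  Real.sqrt_pos.2 (chartGram_posDef g p hu).det_pos

theorem partition_isSubordinate [CompactSpace M] [T2Space M] :
    (partition n M).IsSubordinate fun p => (chartAt (EuclideanSpace ℝ (Fin n)) p).source :=
  Classical.choose_spec (SmoothPartitionOfUnity.exists_isSubordinate_chartAt_source (𝓡 n) M)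

theorem tsupport_partition_subset [CompactSpace M] [T2Space M] (p : M) :
    tsupport (partition n M p) ⊆ (extChartAt (𝓡 n) p).source := by
  rw [extChartAt_source]
  exact partition_isSubordinate p

variable [MeasurableSpace M] [BorelSpace M]

theorem chartVolume_apply (g : Metric n M) (p : M) {s : Set M} (hs : MeasurableSet s) :
    chartVolume g p s = ∫⁻ u in (extChartAt (𝓡 n) p).symm ⁻¹' s ∩ (extChartAt (𝓡 n) p).target,
      ENNReal.ofReal (volDensity g p u) := by
  have hT := (isOpen_chartTarget (n := n) p).measurableSet
  have h1 : AEMeasurable (extChartAt (𝓡 n) p).symm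
      (volume.restrict (extChartAt (𝓡 n) p).target) :=
    (continuousOn_extChartAt_symm p).aemeasurable hT
  rw [chartVolume, Measure.map_apply_of_aemeasurable
    (h1.mono_ac (withDensity_absolutelyContinuous _ _)) hs, withDensity_apply',
    Measure.restrict_restrict' hT]

theorem chartVolume_lt_top (g : Metric n M) (p : M) {s : Set M} (hs : MeasurableSet s)
    (hc : IsCompact s) (hsub : s ⊆ (extChartAt (𝓡 n) p).source) : chartVolume g p s < ⊤ := by
  have himg : (extChartAt (𝓡 n) p).symm ⁻¹' s ∩ (extChartAt (𝓡 n) p).target =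
      extChartAt (𝓡 n) p '' s := by
    rw [(extChartAt (𝓡 n) p).image_eq_target_inter_inv_preimage hsub, Set.inter_comm]
  have hC : IsCompact (extChartAt (𝓡 n) p '' s) :=
    hc.image_of_continuousOn ((continuousOn_extChartAt p).mono hsub)
  have hCT : extChartAt (𝓡 n) p '' s ⊆ (extChartAt (𝓡 n) p).target :=
    himg ▸ Set.inter_subset_right
  obtain ⟨C, hCb⟩ := hC.exists_bound_of_continuousOn ((continuousOn_volDensity g p).mono hCT)
  rw [chartVolume_apply g p hs, himg]
  calc _ ≤ ∫⁻ _ in extChartAt (𝓡 n) p '' s, ENNReal.ofReal C :=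
        setLIntegral_mono' hC.measurableSet fun u hu =>
          ENNReal.ofReal_le_ofReal ((le_abs_self _).trans (hCb u hu))
    _ = ENNReal.ofReal C * volume (extChartAt (𝓡 n) p '' s) := setLIntegral_const _ _
    _ < ⊤ := ENNReal.mul_lt_top ENNReal.ofReal_lt_top hC.measure_lt_top

theorem chartVolume_pos (g : Metric n M) (p : M) {U : Set M} (hU : IsOpen U) {x : M}
    (hx : x ∈ U) (hxp : x ∈ (extChartAt (𝓡 n) p).source) : 0 < chartVolume g p U := by
  have hO : IsOpen ((extChartAt (𝓡 n) p).symm ⁻¹' U ∩ (extChartAt (𝓡 n) p).target) := by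
    rw [Set.inter_comm]
    exact (continuousOn_extChartAt_symm p).isOpen_inter_preimage (isOpen_chartTarget p) hU
  have hne : ((extChartAt (𝓡 n) p).symm ⁻¹' U ∩ (extChartAt (𝓡 n) p).target).Nonempty :=
    ⟨extChartAt (𝓡 n) p x, by
      rw [Set.mem_preimage, (extChartAt (𝓡 n) p).left_inv hxp]; exact hx,
      (extChartAt (𝓡 n) p).map_source hxp⟩
  have hm : AEMeasurable (fun u => ENNReal.ofReal (volDensity g p u)) (volume.restrict
      ((extChartAt (𝓡 n) p).symm ⁻¹' U ∩ (extChartAt (𝓡 n) p).target)) :=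
    (((continuousOn_volDensity g p).mono Set.inter_subset_right).aemeasurable
      hO.measurableSet).ennreal_ofReal
  rw [chartVolume_apply g p hU.measurableSet, pos_iff_ne_zero, Ne, lintegral_eq_zero_iff' hm]
  intro h
  have h' := (ae_restrict_iff' hO.measurableSet).1 h
  refine (hO.measure_pos volume hne).ne' (measure_eq_zero_iff_ae_notMem.2 ?_)
  filter_upwards [h'] with u hu huO
  exact (ENNReal.ofReal_pos.2 (volDensity_pos g p huO.2)).ne' (hu huO)

variable [CompactSpace M] [T2Space M]

instance instIsFiniteMeasureRiemVolume (g : Metric n M) : IsFiniteMeasure (riemVolume g) := by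
  refine ⟨?_⟩
  -- By compactness only finitely many `φ_p` are nonzero, and each piece has at most the chart
  -- volume of the compact support of `φ_p`.
  have hfin := (partition n M).locallyFinite.finite_nonempty_of_compact
  rw [riemVolume, Measure.sum_apply _ MeasurableSet.univ, tsum_eq_sum (s := hfin.toFinset)]
  · refine ENNReal.sum_lt_top.2 fun p _ => ?_
    rw [withDensity_apply _ MeasurableSet.univ, Measure.restrict_univ]
    have hle : ∀ x, ENNReal.ofReal (partition n M p x) ≤
        (tsupport (partition n M p)).indicator 1 x := by
      intro x
      by_cases hx : x ∈ tsupport (partition n M p)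
      · rw [Set.indicator_of_mem hx]
        simpa using (partition n M).le_one p x
      · rw [image_eq_zero_of_notMem_tsupport hx]
        simp
    have hm := (isClosed_tsupport (partition n M p)).measurableSet
    calc _ ≤ ∫⁻ x, (tsupport (partition n M p)).indicator 1 x ∂(chartVolume g p) :=
          lintegral_mono hle
      _ = chartVolume g p (tsupport (partition n M p)) := lintegral_indicator_one hm
      _ < ⊤ := chartVolume_lt_top g p hm (isClosed_tsupport _).isCompact
          (tsupport_partition_subset p)
  · intro p hp
    have h0 : ∀ x, partition n M p x = 0 := by
      intro x
      by_contra hx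
      exact hp (hfin.mem_toFinset.2 ⟨x, hx⟩)
    simp [h0]

theorem riemVolume_pos (g : Metric n M) {U : Set M} (hU : IsOpen U) {x : M} (hx : x ∈ U) :
    0 < riemVolume g U := by
  obtain ⟨p, hp⟩ := (partition n M).exists_pos_of_mem (Set.mem_univ x)
  refine lt_of_lt_of_le ?_ (Measure.le_sum _ p U)
  have hcont : Continuous (partition n M p) := (partition n M p).contMDiff.continuous
  rw [pos_iff_ne_zero, Ne, withDensity_apply_eq_zero hcont.measurable.ennreal_ofReal,
    ← Ne, ← pos_iff_ne_zero]
  have hO : IsOpen ({y | 0 < partition n M p y} ∩ U) :=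
    (isOpen_lt continuous_const hcont).inter hU
  refine (chartVolume_pos g p hO ⟨hp, hx⟩
    (tsupport_partition_subset p (subset_tsupport _ hp.ne'))).trans_le (measure_mono ?_)
  rintro y ⟨hy, hyU⟩
  exact ⟨by simpa using hy, hyU⟩

theorem integrable_of_continuous (g : Metric n M) {f : M → ℝ} (hf : Continuous f) :
    Integrable f (riemVolume g) :=
  hf.integrable_of_hasCompactSupport (HasCompactSupport.of_compactSpace f)

end Volume

/-! ### Smooth approximations of the point mass at `x`. -/

section BumpFilter

variable {n : ℕ} {M : Type*} [TopologicalSpace M] [ChartedSpace (EuclideanSpace ℝ (Fin n)) M]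
  [IsManifold (𝓡 n) ∞ M] [CompactSpace M] [T2Space M] [MeasurableSpace M]

/-- Smooth nonnegative functions of total mass one that are supported in `V`. -/
def unitBumps (g : Metric n M) (V : Set M) : Set (M → ℝ) :=
  {f | ContMDiff (𝓡 n) 𝓘(ℝ) ∞ f ∧ (∀ y, 0 ≤ f y) ∧ Function.support f ⊆ V ∧
    ∫ y, f y ∂(riemVolume g) = 1}

theorem unitBumps_mono (g : Metric n M) : Monotone (unitBumps g) :=
  fun _ _ hVW _ hf => ⟨hf.1, hf.2.1, hf.2.2.1.trans hVW, hf.2.2.2⟩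

/-- The filter of smooth densities of total mass one that concentrate at `x`. -/
def bumpFilter (g : Metric n M) (x : M) : Filter (M → ℝ) :=
  (𝓝 x).lift' (unitBumps g)

theorem eventually_bumpFilter (g : Metric n M) {x : M} {V : Set M} (hV : V ∈ 𝓝 x) :
    ∀ᶠ f in bumpFilter g x, f ∈ unitBumps g V :=
  mem_lift' hV

theorem eventually_smooth_bumpFilter (g : Metric n M) (x : M) :
    ∀ᶠ f in bumpFilter g x, ContMDiff (𝓡 n) 𝓘(ℝ) ∞ f := by
  filter_upwards [eventually_bumpFilter g (univ_mem : Set.univ ∈ 𝓝 x)] with f hf using hf.1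

variable [BorelSpace M]

theorem unitBumps_nonempty (g : Metric n M) {x : M} {V : Set M} (hV : V ∈ 𝓝 x) :
    (unitBumps g V).Nonempty := by
  obtain ⟨ρ, -, hρ⟩ := (SmoothBumpFunction.nhds_basis_support (I := 𝓡 n)
    (univ_mem : Set.univ ∈ 𝓝 x)).mem_iff.1 hV
  have hc : Continuous ρ := ρ.continuous
  have hpos : 0 < ∫ y, ρ y ∂(riemVolume g) := by
    rw [integral_pos_iff_support_of_nonneg (fun y => ρ.nonneg) (integrable_of_continuous g hc)]
    have hx : x ∈ Function.support ρ := by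
      rw [Function.mem_support, ρ.eventuallyEq_one.eq_of_nhds]
      exact one_ne_zero
    exact riemVolume_pos g ρ.isOpen_support hx
  refine ⟨fun y => (∫ y, ρ y ∂(riemVolume g))⁻¹ * ρ y, contMDiff_const.mul ρ.contMDiff,
    fun y => mul_nonneg (inv_nonneg.2 hpos.le) ρ.nonneg, ?_, ?_⟩
  · exact (Function.support_mul_subset_right _ _).trans hρ
  · rw [integral_const_mul, inv_mul_cancel₀ hpos.ne']

instance instNeBotBumpFilter (g : Metric n M) (x : M) : (bumpFilter g x).NeBot :=
  (lift'_neBot_iff (unitBumps_mono g)).2 fun _ hV => unitBumps_nonempty g hV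

/-- An average against a probability density supported in `V` sees only the values of `h` on `V`. -/
theorem abs_average_sub_le (g : Metric n M) {V : Set M} {f : M → ℝ} (hf : f ∈ unitBumps g V)
    {h : M → ℝ} (hh : Continuous h) {t δ : ℝ} (hδ : ∀ z ∈ V, |h z - t| ≤ δ) :
    |∫ z, f z * h z ∂(riemVolume g) - t| ≤ δ := by
  obtain ⟨hs, h0, hsupp, h1⟩ := hf
  have hfc := hs.continuous
  have e1 : ∫ z, f z * h z ∂(riemVolume g) - t = ∫ z, f z * (h z - t) ∂(riemVolume g) := by
    simp_rw [mul_sub]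
    rw [integral_sub (f := fun z => f z * h z) (integrable_of_continuous g (hfc.mul hh))
      ((integrable_of_continuous g hfc).mul_const t), integral_mul_const, h1, one_mul]
  have e2 : ∫ z, f z * δ ∂(riemVolume g) = δ := by rw [integral_mul_const, h1, one_mul]
  rw [e1, ← Real.norm_eq_abs, ← e2]
  refine norm_integral_le_of_norm_le ((integrable_of_continuous g hfc).mul_const δ)
    (Eventually.of_forall fun z => ?_)
  rw [norm_mul, Real.norm_of_nonneg (h0 z)]
  by_cases hz : f z = 0
  · simp [hz]
  · exact mul_le_mul_of_nonneg_left (hδ z (hsupp hz)) (h0 z)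

theorem tendsto_average (g : Metric n M) (x : M) {h : M → ℝ} (hh : Continuous h) :
    Tendsto (fun f : M → ℝ => ∫ z, f z * h z ∂(riemVolume g)) (bumpFilter g x) (𝓝 (h x)) := by
  refine Metric.tendsto_nhds.2 fun ε hε => ?_
  have hV := (Metric.tendsto_nhds.1 (hh.continuousAt (x := x))) (ε / 2) (half_pos hε)
  filter_upwards [eventually_bumpFilter g hV] with f hf
  exact (abs_average_sub_le g hf hh fun z hz => le_of_lt hz).trans_lt (half_lt_self hε)

/-- On a small `V × V` around `(x, x)` the function `H` is nearly constant, so the one-variable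
estimate applies twice. The outer application needs the continuity `hc` of the inner average. -/
theorem tendsto_double_average (g : Metric n M) (x : M) {H : M × M → ℝ} (hH : Continuous H)
    (hc : ∀ᶠ f in bumpFilter g x,
      Continuous fun z => ∫ y, f y * H (z, y) ∂(riemVolume g)) :
    Tendsto (fun f : M → ℝ => ∫ z, f z * ∫ y, f y * H (z, y) ∂(riemVolume g) ∂(riemVolume g))
      (bumpFilter g x) (𝓝 (H (x, x))) := by
  refine Metric.tendsto_nhds.2 fun ε hε => ?_
  have hV := (Metric.tendsto_nhds.1 (hH.continuousAt (x := (x, x)))) (ε / 2) (half_pos hε)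
  rw [nhds_prod_eq, eventually_prod_self_iff'] at hV
  obtain ⟨V, hVx, hV⟩ := hV
  filter_upwards [eventually_bumpFilter g hVx, hc] with f hf hcf
  refine (abs_average_sub_le g hf hcf fun z hz => ?_).trans_lt (half_lt_self hε)
  exact abs_average_sub_le g hf (hH.comp (Continuous.prodMk_right z)) fun y hy =>
    le_of_lt (hV z hz y hy)

end BumpFilter

/-! ### The fibre `Λᵏ T*ₓM` as a Euclidean space. -/

section Pointwise

variable {n k : ℕ} {M : Type*} [TopologicalSpace M] [ChartedSpace (EuclideanSpace ℝ (Fin n)) M]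

theorem finiteDimensional_formAt (x : M) : FiniteDimensional ℝ (FormAt n k x) :=
  finiteDimensional_alternating (F := EuclideanSpace ℝ (Fin n))

theorem finrank_formAt_le (x : M) : Module.finrank ℝ (FormAt n k x) ≤ n.choose k := by
  have h := finrank_alternating_le (k := k) (F := EuclideanSpace ℝ (Fin n))
  rwa [finrank_euclideanSpace_fin] at h

variable [IsManifold (𝓡 n) ∞ M]

/-- The inner product on `Λᵏ T*ₓM` as a bilinear form. -/
def formBilin (g : Metric n M) (x : M) : LinearMap.BilinForm ℝ (FormAt n k x) :=
  frameBilin (gram g x) (stdVec x)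

theorem formBilin_apply (g : Metric n M) (x : M) (a b : FormAt n k x) :
    formBilin g x a b = formInner g x a b := rfl

theorem formBilin_isSymm (g : Metric n M) (x : M) :
    LinearMap.IsSymm (formBilin (k := k) g x) :=
  frameBilin_isSymm _ (gram_posDef g x) _

theorem formInner_comm (g : Metric n M) (x : M) (a b : FormAt n k x) :
    formInner g x a b = formInner g x b a :=
  (formBilin_isSymm g x).eq a b

theorem formInner_self_nonneg (g : Metric n M) (x : M) (a : FormAt n k x) :
    0 ≤ formInner g x a a :=
  frameInner_self_nonneg _ (gram_posDef g x) _ a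

theorem formBilin_pos (g : Metric n M) (x : M) (a : FormAt n k x) (ha : a ≠ 0) :
    0 < formBilin g x a a := by
  refine lt_of_le_of_ne (formInner_self_nonneg g x a) fun h => ha ?_
  have h0 := frame_apply_eq_zero _ (gram_posDef g x) (stdVec x) a h.symm
  apply ContinuousAlternatingMap.toAlternatingMap_injective
  refine Module.Basis.ext_alternating
    (show Module.Basis (Fin n) ℝ (TangentSpace (𝓡 n) x) from
      (EuclideanSpace.basisFun (Fin n) ℝ).toBasis) fun I _ => ?_
  have h1 : ∀ i, (show Module.Basis (Fin n) ℝ (TangentSpace (𝓡 n) x) from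
      (EuclideanSpace.basisFun (Fin n) ℝ).toBasis) i = stdVec x i := fun i =>
    (congrFun (EuclideanSpace.basisFun (Fin n) ℝ).coe_toBasis i).trans
      (EuclideanSpace.basisFun_apply (Fin n) ℝ i)
  simp only [h1]
  exact h0 I

theorem formInner_smul_left (g : Metric n M) (x : M) (c : ℝ) (a b : FormAt n k x) :
    formInner g x (c • a) b = c * formInner g x a b := by
  simp [← formBilin_apply]

theorem formInner_smul_right (g : Metric n M) (x : M) (c : ℝ) (a b : FormAt n k x) :
    formInner g x a (c • b) = c * formInner g x a b := by
  simp [← formBilin_apply]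

theorem formInner_sub_left (g : Metric n M) (x : M) (a a' b : FormAt n k x) :
    formInner g x (a - a') b = formInner g x a b - formInner g x a' b := by
  simp [← formBilin_apply]

theorem formInner_sq_le (g : Metric n M) (x : M) (a b : FormAt n k x) :
    formInner g x a b ^ 2 ≤ formInner g x a a * formInner g x b b :=
  (formBilin g x).apply_sq_le_of_symm (formInner_self_nonneg g x) (formBilin_isSymm g x) a b

theorem exists_orthogonal_basis_formAt (g : Metric n M) (x : M) :
    ∃ b : Module.Basis (Fin (Module.finrank ℝ (FormAt n k x))) ℝ (FormAt n k x),
      LinearMap.IsOrthoᵢ (formBilin g x) b :=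
  haveI := finiteDimensional_formAt (k := k) (n := n) x
  LinearMap.BilinForm.exists_orthogonal_basis (formBilin_isSymm g x)

end Pointwise

/-! ### The `L²` pairing, scaling of harmonic forms, and the kernel. -/

section Global

variable {n k : ℕ} {M : Type*} [TopologicalSpace M] [ChartedSpace (EuclideanSpace ℝ (Fin n)) M]

theorem extD_const_smul (c : ℝ) (α : Form n k M) : extD (c • α) = c • extD α := by
  funext x
  have h : inChart (c • α) x = c • inChart α x := rfl
  simp only [extD, h, extDeriv_smul, Pi.smul_apply]
  rfl

variable [IsManifold (𝓡 n) ∞ M] [CompactSpace M] [T2Space M] [MeasurableSpace M]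

theorem l2Inner_smul_left (g : Metric n M) (c : ℝ) (α β : Form n k M) :
    l2Inner g (c • α) β = c * l2Inner g α β := by
  simp only [l2Inner, Pi.smul_apply, formInner_smul_left, integral_const_mul]

theorem l2Inner_smul_right (g : Metric n M) (c : ℝ) (α β : Form n k M) :
    l2Inner g α (c • β) = c * l2Inner g α β := by
  simp only [l2Inner, Pi.smul_apply, formInner_smul_right, integral_const_mul]

theorem l2Inner_self_nonneg (g : Metric n M) (α : Form n k M) : 0 ≤ l2Inner g α α :=
  integral_nonneg fun x => formInner_self_nonneg g x (α x)

theorem IsCodifferential.const_smul {g : Metric n M} {α : Form n (k + 1) M} {β : Form n k M}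
    (h : IsCodifferential g α β) (c : ℝ) : IsCodifferential g (c • α) (c • β) :=
  ⟨h.1.const_smul c, fun γ hγ => by rw [l2Inner_smul_left, l2Inner_smul_left, h.2 γ hγ]⟩

theorem IsLaplacian.const_smul {g : Metric n M} {α η : Form n k M} (h : IsLaplacian g α η)
    (c : ℝ) : IsLaplacian g (c • α) (c • η) := by
  cases k with
  | zero =>
    have h' : IsCodifferential g (extD α) η := h
    have h2 := h'.const_smul c
    rw [← extD_const_smul] at h2
    exact h2
  | succ k =>
    obtain ⟨β, ζ, hβ, hζ, rfl⟩ := h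
    have hζ' := hζ.const_smul c
    rw [← extD_const_smul] at hζ'
    exact ⟨c • β, c • ζ, hβ.const_smul c, hζ', by rw [extD_const_smul, smul_add]⟩

theorem IsHarmonic.const_smul {g : Metric n M} {α : Form n k M} (h : IsHarmonic g α) (c : ℝ) :
    IsHarmonic g (c • α) :=
  ⟨h.1.const_smul c, by simpa using h.2.const_smul c⟩

/-- Normalize `η` to unit `L²` norm; both sides are quadratic in `η`. -/
theorem formInner_le_of_bddAbove (g : Metric n M) {x : M} (hb : BddAbove (peakValues g k x))
    {η : Form n k M} (hη : IsHarmonic g η) (hpos : 0 < l2Inner g η η) :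
    formInner g x (η x) (η x) ≤ sSup (peakValues g k x) * l2Inner g η η := by
  set q := l2Inner g η η with hq
  have hs : (Real.sqrt q)⁻¹ * (Real.sqrt q)⁻¹ = q⁻¹ := by
    rw [← mul_inv, Real.mul_self_sqrt hpos.le]
  have hmem : q⁻¹ * formInner g x (η x) (η x) ∈ peakValues g k x := by
    refine ⟨(Real.sqrt q)⁻¹ • η, hη.const_smul _, ?_, ?_⟩
    · rw [l2Inner_smul_left, l2Inner_smul_right, ← mul_assoc, hs, ← hq, inv_mul_cancel₀ hpos.ne']
    · rw [Pi.smul_apply, formInner_smul_left, formInner_smul_right, ← mul_assoc, hs]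
  have h := le_csSup hb hmem
  rwa [inv_mul_le_iff₀ hpos, mul_comm] at h

theorem l2Inner_comm (g : Metric n M) (α β : Form n k M) : l2Inner g α β = l2Inner g β α := by
  simp only [l2Inner, formInner_comm g _ (α _)]

/-- This includes the case of no unit harmonic form, where `sSup ∅ = 0` agrees with the convention
for a zero space. -/
theorem sSup_peakValues_nonneg (g : Metric n M) (x : M) : 0 ≤ sSup (peakValues g k x) := by
  refine Real.sSup_nonneg ?_
  rintro r ⟨α, -, -, rfl⟩
  exact formInner_self_nonneg g x (α x)

/-- The diagonal pairing `(z, y) ↦ ⟨K(z, y) θ(y), θ(z)⟩`. -/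
def kernelPairing (g : Metric n M) (K : (x y : M) → FormAt n k y →ₗ[ℝ] FormAt n k x)
    (θ : Form n k M) (q : M × M) : ℝ :=
  formInner g q.1 (K q.1 q.2 (θ q.2)) (θ q.1)

theorem continuous_kernelPairing {g : Metric n M}
    {K : (x y : M) → FormAt n k y →ₗ[ℝ] FormAt n k x} (hK : IsHarmonicKernel g K) {θ : Form n k M}
    (hθ : IsSmooth θ) : Continuous (kernelPairing g K θ) :=
  hK.1 θ θ hθ hθ

variable [BorelSpace M]

theorem integrable_formInner (g : Metric n M) {α β : Form n k M} (hα : IsSmooth α)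
    (hβ : IsSmooth β) : Integrable (fun x => formInner g x (α x) (β x)) (riemVolume g) :=
  integrable_of_continuous g (continuous_formInner g hα hβ)

theorem l2Inner_sub_left (g : Metric n M) {α α' β : Form n k M} (hα : IsSmooth α)
    (hα' : IsSmooth α') (hβ : IsSmooth β) :
    l2Inner g (α - α') β = l2Inner g α β - l2Inner g α' β := by
  simp only [l2Inner, Pi.sub_apply, formInner_sub_left]
  exact integral_sub (integrable_formInner g hα hβ) (integrable_formInner g hα' hβ)

/-- Cauchy–Schwarz from the discriminant of `t ↦ ‖α - t β‖²`; smoothness provides the integrability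
needed to expand it. -/
theorem l2Inner_sq_le (g : Metric n M) {α β : Form n k M} (hα : IsSmooth α) (hβ : IsSmooth β) :
    l2Inner g α β ^ 2 ≤ l2Inner g α α * l2Inner g β β := by
  have h : ∀ t : ℝ, 0 ≤ l2Inner g β β * (t * t) + (-2 * l2Inner g α β) * t + l2Inner g α α := by
    intro t
    have hs : IsSmooth (α - t • β) := hα.sub (hβ.const_smul t)
    have h0 := l2Inner_self_nonneg g (α - t • β)
    rw [l2Inner_sub_left g hα (hβ.const_smul t) hs, l2Inner_comm g α, l2Inner_smul_left,
      l2Inner_comm g β, l2Inner_sub_left g hα (hβ.const_smul t) hα,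
      l2Inner_sub_left g hα (hβ.const_smul t) hβ, l2Inner_smul_left, l2Inner_smul_left,
      l2Inner_comm g β α] at h0
    linarith
  have h2 := discrim_le_zero h
  rw [discrim] at h2
  linarith

/-- Pairing the image of `θ` under a kernel with a smooth form, as an integral. -/
theorem formInner_kernel_apply {g : Metric n M}
    {K : (x y : M) → FormAt n k y →ₗ[ℝ] FormAt n k x} (hK : IsHarmonicKernel g K)
    {θ η ζ : Form n k M} (hθ : IsSmooth θ) (z : M)
    (hη : ∀ v : Fin k → TangentSpace (𝓡 n) z, η z v = ∫ y, K z y (θ y) v ∂(riemVolume g)) :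
    formInner g z (η z) (ζ z) = ∫ y, formInner g z (K z y (θ y)) (ζ z) ∂(riemVolume g) := by
  obtain ⟨b, hb⟩ := exists_orthogonal_basis_formAt (k := k) g z
  -- Continuity of `K` is only known against smooth forms. Extending each basis vector of the fibre
  -- at `z` to a smooth form makes the coordinates of `K z y (θ y)` continuous in `y`.
  have hint : ∀ v : Fin k → TangentSpace (𝓡 n) z,
      Integrable (fun y => K z y (θ y) v) (riemVolume g) := by
    intro v
    refine integrable_of_continuous g ?_
    have hc : ∀ i, Continuous fun y => formInner g z (K z y (θ y)) (b i) := by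
      intro i
      obtain ⟨ξ, hξ, hξz⟩ := exists_smooth_form z (b i)
      have h := (hK.1 θ ξ hθ hξ).comp (Continuous.prodMk_right z)
      simpa only [Function.comp_def, hξz] using h
    have heq : (fun y => K z y (θ y) v) = fun y => ∑ i,
        formInner g z (K z y (θ y)) (b i) / formBilin g z (b i) (b i) * b i v := by
      funext y
      conv_lhs => rw [← b.sum_repr (K z y (θ y))]
      rw [ContinuousAlternatingMap.sum_apply]
      refine Finset.sum_congr rfl fun i _ => ?_
      rw [orthogonal_repr (formBilin g z) (formBilin_pos g z) b hb]
      rfl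
    rw [heq]
    exact continuous_finsetSum _ fun i _ => ((hc i).div_const _).mul continuous_const
  simp only [formInner, hη]
  rw [integral_const_mul, integral_finsetSum]
  · congr 1
    refine Finset.sum_congr rfl fun I _ => ?_
    rw [integral_finsetSum]
    · refine Finset.sum_congr rfl fun J _ => ?_
      rw [integral_mul_const, integral_const_mul]
    · exact fun J _ => ((hint _).const_mul _).mul_const _
  · exact fun I _ => integrable_finsetSum _ fun J _ => ((hint _).const_mul _).mul_const _

/-- The harmonic projection of `f θ`, and its pairings in terms of the kernel. -/
theorem exists_projection_of_smul {g : Metric n M}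
    {K : (x y : M) → FormAt n k y →ₗ[ℝ] FormAt n k x} (hK : IsHarmonicKernel g K)
    {θ : Form n k M} (hθ : IsSmooth θ) {f : M → ℝ} (hf : ContMDiff (𝓡 n) 𝓘(ℝ) ∞ f) :
    ∃ η : Form n k M, IsHarmonic g η ∧
      (∀ h, IsHarmonic g h →
        ∫ z, f z * formInner g z (θ z) (h z) ∂(riemVolume g) = l2Inner g η h) ∧
      ∀ z, formInner g z (η z) (θ z) = ∫ y, f y * kernelPairing g K θ (z, y) ∂(riemVolume g) := by
  have hfθ := hθ.fun_smul hf
  obtain ⟨η, ⟨hη, horth⟩, hformula⟩ := hK.2 _ hfθ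
  refine ⟨η, hη, fun h hh => ?_, fun z => ?_⟩
  · have h0 := horth h hh
    rw [l2Inner_sub_left g hfθ hη.1 hh.1, sub_eq_zero] at h0
    rw [← h0]
    simp only [l2Inner, formInner_smul_left]
  · rw [formInner_kernel_apply hK hfθ z (hformula z)]
    simp only [map_smul, formInner_smul_left, kernelPairing]

/-! ### Limits of projections of concentrating forms. -/

variable {g : Metric n M} {K : (x y : M) → FormAt n k y →ₗ[ℝ] FormAt n k x}

theorem tendsto_energy (hK : IsHarmonicKernel g K) {θ : Form n k M} (hθ : IsSmooth θ) (x : M) :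
    Tendsto (fun f : M → ℝ => ∫ z, f z * ∫ y, f y * kernelPairing g K θ (z, y)
      ∂(riemVolume g) ∂(riemVolume g)) (bumpFilter g x) (𝓝 (kernelPairing g K θ (x, x))) := by
  refine tendsto_double_average g x (continuous_kernelPairing hK hθ) ?_
  filter_upwards [eventually_smooth_bumpFilter g x] with f hf
  obtain ⟨η, hη, -, hη2⟩ := exists_projection_of_smul hK hθ hf
  -- The inner average is `⟨η, θ⟩`, continuous because the projection `η` is smooth.
  simpa only [hη2] using continuous_formInner g hη.1 hθ

theorem exists_projection_energy (hK : IsHarmonicKernel g K) {θ : Form n k M}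
    (hθ : IsSmooth θ) {f : M → ℝ} (hf : ContMDiff (𝓡 n) 𝓘(ℝ) ∞ f) :
    ∃ η : Form n k M, IsHarmonic g η ∧
      (∀ h, IsHarmonic g h →
        ∫ z, f z * formInner g z (θ z) (h z) ∂(riemVolume g) = l2Inner g η h) ∧
      (∀ z, formInner g z (η z) (θ z) =
        ∫ y, f y * kernelPairing g K θ (z, y) ∂(riemVolume g)) ∧
      l2Inner g η η = ∫ z, f z * ∫ y, f y * kernelPairing g K θ (z, y)
        ∂(riemVolume g) ∂(riemVolume g) := by
  obtain ⟨η, hη, hη1, hη2⟩ := exists_projection_of_smul hK hθ hf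
  refine ⟨η, hη, hη1, hη2, ?_⟩
  -- Test orthogonality against `η` itself: `‖η‖² = ⟨f θ, η⟩`.
  rw [← hη1 η hη]
  simp only [← hη2, formInner_comm g _ (θ _)]

theorem kernelPairing_diag_nonneg (hK : IsHarmonicKernel g K) {θ : Form n k M}
    (hθ : IsSmooth θ) (x : M) : 0 ≤ kernelPairing g K θ (x, x) := by
  refine ge_of_tendsto (tendsto_energy hK hθ x) ?_
  filter_upwards [eventually_smooth_bumpFilter g x] with f hf
  obtain ⟨η, hη, -, -, hq⟩ := exists_projection_energy hK hθ hf
  exact hq ▸ l2Inner_self_nonneg g η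

theorem formInner_sq_le_kernelPairing (hK : IsHarmonicKernel g K) {θ : Form n k M}
    (hθ : IsSmooth θ) (x : M) {α : Form n k M} (hα : IsHarmonic g α) :
    formInner g x (θ x) (α x) ^ 2 ≤ kernelPairing g K θ (x, x) * l2Inner g α α := by
  refine le_of_tendsto_of_tendsto
    ((tendsto_average g x (continuous_formInner g hθ hα.1)).pow 2)
    ((tendsto_energy hK hθ x).mul_const _) ?_
  filter_upwards [eventually_smooth_bumpFilter g x] with f hf
  obtain ⟨η, hη, hη1, -, hq⟩ := exists_projection_energy hK hθ hf
  rw [hη1 α hα, ← hq]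
  exact l2Inner_sq_le g hη.1 hα.1

/-- The diagonal value is the limit both of `⟨η(x), θ(x)⟩` and of `‖η‖²`. The first enters squared
and the second linearly, so one factor cancels. -/
theorem kernelPairing_diag_le (hK : IsHarmonicKernel g K) {θ : Form n k M}
    (hθ : IsSmooth θ) (x : M) (hb : BddAbove (peakValues g k x)) :
    kernelPairing g K θ (x, x) ≤ formInner g x (θ x) (θ x) * sSup (peakValues g k x) := by
  -- Strict positivity is used twice: to normalize `η`, whose norm is then eventually nonzero, and
  -- for the final division.
  rcases (kernelPairing_diag_nonneg hK hθ x).eq_or_lt with h0 | hpos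
  · rw [← h0]
    exact mul_nonneg (formInner_self_nonneg g x _) (sSup_peakValues_nonneg g x)
  have hR : Tendsto (fun f : M → ℝ => ∫ y, f y * kernelPairing g K θ (x, y) ∂(riemVolume g))
      (bumpFilter g x) (𝓝 (kernelPairing g K θ (x, x))) :=
    tendsto_average g x ((continuous_kernelPairing hK hθ).comp (Continuous.prodMk_right x))
  have hQ := tendsto_energy hK hθ x
  have hle : kernelPairing g K θ (x, x) ^ 2 ≤
      (formInner g x (θ x) (θ x) * sSup (peakValues g k x)) * kernelPairing g K θ (x, x) := by
    refine le_of_tendsto_of_tendsto (hR.pow 2) (hQ.const_mul _) ?_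
    filter_upwards [eventually_smooth_bumpFilter g x, hQ.eventually_const_lt hpos] with f hf hfpos
    obtain ⟨η, hη, -, hη2, hq⟩ := exists_projection_energy hK hθ hf
    rw [← hq] at hfpos ⊢
    rw [← hη2 x]
    calc _ ≤ formInner g x (η x) (η x) * formInner g x (θ x) (θ x) := formInner_sq_le g x _ _
      _ ≤ (sSup (peakValues g k x) * l2Inner g η η) * formInner g x (θ x) (θ x) :=
          mul_le_mul_of_nonneg_right (formInner_le_of_bddAbove g hb hη hfpos)
            (formInner_self_nonneg g x _)
      _ = _ := by ring
  rw [sq] at hle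
  exact le_of_mul_le_mul_right hle hpos

end Global

end

end HarmonicKernel

theorem mainTheorem9 {n k : ℕ} {M : Type*} [TopologicalSpace M]
    [ChartedSpace (EuclideanSpace ℝ (Fin n)) M] [IsManifold (𝓡 n) ∞ M]
    [CompactSpace M] [T2Space M] [MeasurableSpace M] [BorelSpace M]
    (g : HarmonicKernel.Metric n M)
    (K : (x y : M) → HarmonicKernel.FormAt n k y →ₗ[ℝ] HarmonicKernel.FormAt n k x)
    (hK : HarmonicKernel.IsHarmonicKernel g K) (x : M) :
    BddAbove (HarmonicKernel.peakValues g k x) ∧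
      0 ≤ LinearMap.trace ℝ (HarmonicKernel.FormAt n k x) (K x x) ∧
      LinearMap.trace ℝ (HarmonicKernel.FormAt n k x) (K x x) ≤
        (n.choose k : ℝ) * sSup (HarmonicKernel.peakValues g k x) := by
  open HarmonicKernel in
  obtain ⟨b, hb⟩ := exists_orthogonal_basis_formAt (k := k) g x
  have hbpos : ∀ i, 0 < formBilin g x (b i) (b i) := fun i => formBilin_pos g x _ (b.ne_zero i)
  choose θ hθ hθx using fun i => exists_smooth_form x (b i)
  have hpair : ∀ i, formBilin g x (K x x (b i)) (b i) = kernelPairing g K (θ i) (x, x) := by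
    intro i
    simp only [kernelPairing, hθx, formBilin_apply]
  have htrace : LinearMap.trace ℝ (FormAt n k x) (K x x) =
      ∑ i, kernelPairing g K (θ i) (x, x) / formBilin g x (b i) (b i) := by
    simp only [orthogonal_trace (formBilin g x) (formBilin_pos g x) b hb, hpair]
  have hbdd : BddAbove (peakValues g k x) := by
    -- The trace itself is an upper bound: compare it term by term with the Parseval expansion of
    -- `|α(x)|²`.
    refine ⟨LinearMap.trace ℝ (FormAt n k x) (K x x), ?_⟩
    rintro r ⟨α, hα, h1, rfl⟩
    rw [htrace, ← formBilin_apply, orthogonal_self (formBilin g x) (formBilin_pos g x) b hb]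
    refine Finset.sum_le_sum fun i _ => div_le_div_of_nonneg_right ?_ (hbpos i).le
    have h := formInner_sq_le_kernelPairing hK (hθ i) x hα
    rwa [h1, mul_one, hθx, formInner_comm] at h
  refine ⟨hbdd, ?_, ?_⟩
  · rw [htrace]
    exact Finset.sum_nonneg fun i _ =>
      div_nonneg (kernelPairing_diag_nonneg hK (hθ i) x) (hbpos i).le
  · calc LinearMap.trace ℝ (FormAt n k x) (K x x)
        ≤ ∑ _i : Fin (Module.finrank ℝ (FormAt n k x)), sSup (peakValues g k x) := by
          rw [htrace]
          refine Finset.sum_le_sum fun i _ => ?_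
          rw [div_le_iff₀ (hbpos i), mul_comm]
          have h := kernelPairing_diag_le hK (hθ i) x hbdd
          rwa [hθx] at h
      _ = (Module.finrank ℝ (FormAt n k x) : ℝ) * sSup (peakValues g k x) := by simp
      _ ≤ (n.choose k : ℝ) * sSup (peakValues g k x) :=
          mul_le_mul_of_nonneg_right (by exact_mod_cast finrank_formAt_le x)
            (sSup_peakValues_nonneg g x)
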